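/- Let $\mathcal{F}$ be a finite family of binary matrices (of possibly different finite dimensions) that is closed under row permutations, i.e. every matrix obtained by permuting the rows of a matrix in $\mathcal{F}$ is again in $\mathcal{F}$. A copy of an $s\times t$ matrix $A$ in a matrix $M$ is an $s\times t$ submatrix of $M$ (obtained by deleting rows and columns while preserving the order of the remaining ones, and identified by its sets of row and column indices) that is equal to $A$. A matrix is $\mathcal{F}$-free if it contains no copy of any member of $\mathcal{F}$, and an $n\times n$ binary matrix is $\epsilon$-far from $\mathcal{F}$-freeness if every $\mathcal{F}$-free $n\times n$ binary matrix differs from it in at least $\epsilon n^2$ entries. Then there is a polynomial $p$ with real coefficients, depending only on $\mathcal{F}$, such that for every $\epsilon>0$ there exists $\delta>0$ with $\delta^{-1}\le p(\epsilon^{-1})$ and the following property: for every $n\ge 1$, every $n\times n$ binary matrix $M$ that is $\epsilon$-far from $\mathcal{F}$-freeness contains at least $\delta n^{s+t}$ copies of some $s\times t$ matrix $A\in\mathcal{F}$ (where $A$, and hence $s$ and $t$, may depend on $M$). -/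

import Mathlib

/-- The type of all finite matrices, of arbitrary dimensions, over the alphabet `Γ`. -/
abbrev AnyMatrix (Γ : Type*) := Σ s : ℕ, Σ t : ℕ, Matrix (Fin s) (Fin t) Γ

/-- The copies of `A` in `M`. A submatrix of `M` (row and column order preserved) is given by a
set of rows and a set of columns, i.e. by strictly increasing maps of the row and column indices;
it is a copy of `A` if it is equal to `A`. -/
def matrixCopies {Γ : Type*} {s t m n : ℕ} (A : Matrix (Fin s) (Fin t) Γ)
    (M : Matrix (Fin m) (Fin n) Γ) : Set ((Fin s ↪o Fin m) × (Fin t ↪o Fin n)) :=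
  {e | M.submatrix e.1 e.2 = A}

/-- There are finitely many copies, so that their number `Set.ncard` is meaningful. -/
theorem matrixCopies_finite {Γ : Type*} {s t m n : ℕ} (A : Matrix (Fin s) (Fin t) Γ)
    (M : Matrix (Fin m) (Fin n) Γ) : (matrixCopies A M).Finite := by
  have h (a b : ℕ) : Finite (Fin a ↪o Fin b) :=
    Finite.of_injective (fun e : Fin a ↪o Fin b => (e : Fin a → Fin b)) DFunLike.coe_injective
  have := h s m
  have := h t n
  exact Set.toFinite _

/-- The number of copies of `A` in `M`. -/
noncomputable def numCopies {Γ : Type*} {s t m n : ℕ} (A : Matrix (Fin s) (Fin t) Γ)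
    (M : Matrix (Fin m) (Fin n) Γ) : ℕ :=
  (matrixCopies A M).ncard

/-- The property of `F`-freeness: all matrices that contain no submatrix from `F`. -/
def matrixFreeness {Γ : Type*} (F : Set (AnyMatrix Γ)) : Set (AnyMatrix Γ) :=
  {M | ∀ A ∈ F, matrixCopies A.2.2 M.2.2 = ∅}

/-- The number of entries in which two matrices of the same dimensions differ. -/
noncomputable def numChanges {Γ : Type*} {m n : ℕ} (M N : Matrix (Fin m) (Fin n) Γ) : ℕ :=
  {p : Fin m × Fin n | M p.1 p.2 ≠ N p.1 p.2}.ncard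

/-- `M` is `ε`-far from the property `P`: at least an `ε`-fraction of the entries of `M` has to be
changed to get a matrix (of the same dimensions) that satisfies `P`. -/
def IsFarFrom {Γ : Type*} {m n : ℕ} (ε : ℝ) (P : Set (AnyMatrix Γ))
    (M : Matrix (Fin m) (Fin n) Γ) : Prop :=
  ∀ N : Matrix (Fin m) (Fin n) Γ, (⟨m, n, N⟩ : AnyMatrix Γ) ∈ P →
    ε * ((m : ℝ) * (n : ℝ)) ≤ (numChanges M N : ℝ)

/-- Permuting the rows of any matrix of `F` gives a matrix of `F`. -/
def ClosedUnderRowPerm {Γ : Type*} (F : Set (AnyMatrix Γ)) : Prop :=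
  ∀ (s t : ℕ) (A : Matrix (Fin s) (Fin t) Γ), (⟨s, t, A⟩ : AnyMatrix Γ) ∈ F →
    ∀ σ : Equiv.Perm (Fin s), (⟨s, t, A.submatrix σ id⟩ : AnyMatrix Γ) ∈ F

/-! Since `F` is closed under row permutations, it suffices to find many copies up to the order of
the rows (`patternCount`); sorting the rows costs only a factor `s!`. Two rows count as close when
they differ in at most `β * n` columns.

Suppose that at least `β * n` rows have few rows close to them. A random sample of polynomially many
of these rows and of polynomially many columns then has pairwise distinct rows with probability at
least 1/2. By Sauer–Shelah, so many distinct rows shatter enough columns to exhibit any prescribed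
small matrix, so every small matrix is abundant (`exists_patternCount_bound`).

Otherwise almost all rows have many close rows and lie near a net of polynomially many rows
(`exists_small_net`). For each `A` in `F` and each assignment of net rows to the rows of `A`, either
the columns of `A` occur in order in long blocks, or few columns hit all weakly ordered occurrences
(`exists_blocks_or_hitting`). If hitting sets always existed, moving rows to the net and overwriting
the hit columns would cheaply produce an `F`-free matrix (`IsFarFrom.exists_blocks`). Hence some `A`
occurs in long blocks; its rows can be exchanged for close rows and its columns moved inside the
blocks (`patternCount_of_blocks`).

Two scales of closeness are needed: the block length depends on the size of the net, hence on the
first scale, while the exchanged rows must differ in far fewer columns than a block has. -/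

/-! ### Shattering: small patterns among many distinct rows -/

open Finset in
theorem exists_shatters_of_card_lt {q : ℕ} (hq : 0 < q) (K : ℕ) (𝒜 : Finset (Finset (Fin q)))
    (h : (K + 1) * q ^ K < #𝒜) : ∃ J : Finset (Fin q), 𝒜.Shatters J ∧ K ≤ #J := by
  by_contra! hc
  have h1 : 𝒜.vcDim ≤ K := Finset.sup_le fun J hJ => (hc J (mem_shatterer.1 hJ)).le
  have h2 := 𝒜.card_le_card_shatterer.trans card_shatterer_le_sum_vcDim
  -- Crude Sauer–Shelah bound: each of the `K + 1` binomial coefficients is at most `q ^ K`.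
  have h3 : ∑ k ∈ Iic 𝒜.vcDim, (Fintype.card (Fin q)).choose k ≤ ∑ _k ∈ Iic K, q ^ K := by
    refine (Finset.sum_le_sum_of_subset (Iic_subset_Iic.2 h1)).trans (Finset.sum_le_sum ?_)
    intro i hi
    rw [Fintype.card_fin]
    exact (Nat.choose_le_pow q i).trans (Nat.pow_le_pow_right hq (mem_Iic.1 hi))
  simp at h3
  simp at h2
  omega

/-- A matrix with many distinct rows contains every small pattern up to the order of its rows. -/
theorem exists_pattern {α C : Type*} [LinearOrder C] (M : α → C → Fin 2) {m q s t : ℕ}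
    (hq : 0 < q) (hm : (t + s + 1) * q ^ (t + s) < m) (x : Fin m → α) (y : Fin q → C)
    (hxy : Function.Injective fun i j => M (x i) (y j)) (A : Matrix (Fin s) (Fin t) (Fin 2)) :
    ∃ (i : Fin s → Fin m) (j : Fin t → Fin q), Function.Injective (x ∘ i) ∧
      StrictMono (y ∘ j) ∧ ∀ a b, M (x (i a)) (y (j b)) = A a b := by
  classical
  have fin2 : ∀ u v : Fin 2, (u = 1 ↔ v = 1) → u = v := by decide
  let f : Fin m → Finset (Fin q) := fun i => Finset.univ.filter fun j => M (x i) (y j) = 1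
  have hf : Function.Injective f := by
    intro i i' h
    apply hxy
    funext j
    apply fin2
    have := Finset.ext_iff.1 h j
    simpa [f] using this
  have hcard : (Finset.univ.image f).card = m := by
    rw [Finset.card_image_of_injective _ hf, Finset.card_univ, Fintype.card_fin]
  obtain ⟨J, hJ, hJK⟩ := exists_shatters_of_card_lt hq (t + s) (Finset.univ.image f)
    (by rw [hcard]; exact hm)
  have key : ∀ B : Finset (Fin q), B ⊆ J → ∃ i, ∀ j ∈ J, M (x i) (y j) = 1 ↔ j ∈ B := by
    intro B hB
    obtain ⟨u, hu, huB⟩ := hJ hB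
    obtain ⟨i, -, rfl⟩ := Finset.mem_image.1 hu
    refine ⟨i, fun j hj => ?_⟩
    have := Finset.ext_iff.1 huB j
    simp only [Finset.mem_inter, hj, true_and, f, Finset.mem_filter, Finset.mem_univ] at this
    exact this
  -- `y` may repeat columns or be unordered. Equal columns cannot be separated, so `y` is injective
  -- on a shattered set, whose values can then be listed increasingly.
  have yinj : Set.InjOn y J := by
    intro j hj j' hj' h
    obtain ⟨i, hi⟩ := key {j} (by simpa using hj)
    have h1 := hi j hj
    have h2 := hi j' hj'
    rw [h] at h1
    simpa using (h2.symm.trans h1).2 (by simp) |> fun h => (Finset.mem_singleton.1 h).symm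
  obtain ⟨P, hPJ, hP⟩ := Finset.exists_subset_card_eq
    (show t + s ≤ (J.image y).card by rwa [Finset.card_image_of_injOn yinj])
  let e := P.orderEmbOfFin hP
  have he : ∀ l, ∃ j ∈ J, y j = e l := fun l => by
    simpa using hPJ (P.orderEmbOfFin_mem hP l)
  choose g hgJ hg using he
  have ginj : Function.Injective g := by
    intro l l' h
    apply e.injective
    rw [← hg, ← hg, h]
  -- The first `t` columns carry `A`; the other `s` carry an identity matrix, which forces the
  -- chosen rows to be distinct even if `A` has equal rows.
  have hrow : ∀ a : Fin s, ∃ i, (∀ b : Fin t, M (x i) (y (g (Fin.castAdd s b))) = A a b) ∧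
      ∀ a' : Fin s, M (x i) (y (g (Fin.natAdd t a'))) = 1 ↔ a' = a := by
    intro a
    obtain ⟨i, hi⟩ := key ((Finset.univ.filter
      fun l : Fin (t + s) => Fin.addCases (fun b => A a b = 1) (fun a' => a' = a) l).image g)
      (by intro j hj; obtain ⟨l, -, rfl⟩ := Finset.mem_image.1 hj; exact hgJ l)
    refine ⟨i, fun b => fin2 _ _ ?_, fun a' => ?_⟩
    · rw [hi _ (hgJ _), ginj.mem_finset_image]
      simp
    · rw [hi _ (hgJ _), ginj.mem_finset_image]
      simp
  choose i hi hi' using hrow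
  refine ⟨i, fun b => g (Fin.castAdd s b), ?_, ?_, fun a b => hi a b⟩
  · intro a a' h
    have h1 := (hi' a a).2 rfl
    have h2 : x (i a) = x (i a') := h
    rw [h2] at h1
    exact (hi' a' a).1 h1
  · intro b b' h
    simp only [Function.comp, hg]
    exact e.strictMono ((Fin.strictMono_castAdd s) h)

/-! ### Random samples of rows and columns -/

theorem card_compl_range_add {s m : ℕ} (i : Fin s → Fin m) (hi : Function.Injective i)
    [Fintype {l // l ∉ Set.range i}] : Fintype.card {l // l ∉ Set.range i} + s = m := by
  have h := Set.ncard_add_ncard_compl (Set.range i)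
  rw [← Set.image_univ, Set.ncard_image_of_injective _ hi, Set.ncard_univ, Nat.card_fin,
    Nat.card_fin, Set.image_univ, ← Nat.card_coe_set_eq] at h
  rw [← Nat.card_eq_fintype_card, add_comm]
  exact h

/-- A uniform sample restricted to distinct positions is again uniform: it is determined by its
restriction and its remaining coordinates. -/
theorem card_comp_mem_mul_le {α C : Type*} [Fintype α] [Fintype C] {s t m q : ℕ}
    (i : Fin s → Fin m) (hi : Function.Injective i) (j : Fin t → Fin q)
    (hj : Function.Injective j) (P : Set ((Fin s → α) × (Fin t → C))) :
    {p : (Fin m → α) × (Fin q → C) | (p.1 ∘ i, p.2 ∘ j) ∈ P}.ncard *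
        (Fintype.card α ^ s * Fintype.card C ^ t) ≤
      P.ncard * (Fintype.card α ^ m * Fintype.card C ^ q) := by
  classical
  let Q := {p : (Fin m → α) × (Fin q → C) | (p.1 ∘ i, p.2 ∘ j) ∈ P}
  let U := {l : Fin m // l ∉ Set.range i}
  let V := {l : Fin q // l ∉ Set.range j}
  have hU : Fintype.card U + s = m := card_compl_range_add i hi
  have hV : Fintype.card V + t = q := card_compl_range_add j hj
  let φ : Q → P × ((U → α) × (V → C)) := fun p =>
    (⟨(p.1.1 ∘ i, p.1.2 ∘ j), p.2⟩, (fun u => p.1.1 u.1, fun v => p.1.2 v.1))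
  have hφ : Function.Injective φ := by
    rintro ⟨⟨x, y⟩, hp⟩ ⟨⟨x', y'⟩, hp'⟩ h
    simp only [φ, Prod.mk.injEq, Subtype.mk.injEq] at h
    obtain ⟨⟨h1, h2⟩, h3, h4⟩ := h
    simp only [Subtype.mk.injEq, Prod.mk.injEq]
    constructor
    · funext l
      by_cases hl : l ∈ Set.range i
      · obtain ⟨a, rfl⟩ := hl; exact congrFun h1 a
      · exact congrFun h3 ⟨l, hl⟩
    · funext l
      by_cases hl : l ∈ Set.range j
      · obtain ⟨a, rfl⟩ := hl; exact congrFun h2 a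
      · exact congrFun h4 ⟨l, hl⟩
  have h := Fintype.card_le_of_injective φ hφ
  rw [Fintype.card_prod, Fintype.card_prod, Fintype.card_fun, Fintype.card_fun,
    ← Nat.card_eq_fintype_card (α := Q), ← Nat.card_eq_fintype_card (α := P),
    Nat.card_coe_set_eq, Nat.card_coe_set_eq] at h
  calc _ ≤ (P.ncard * (Fintype.card α ^ Fintype.card U * Fintype.card C ^ Fintype.card V)) *
        (Fintype.card α ^ s * Fintype.card C ^ t) := Nat.mul_le_mul_right _ h
    _ = P.ncard * (Fintype.card α ^ (Fintype.card U + s) *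
        Fintype.card C ^ (Fintype.card V + t)) := by rw [pow_add, pow_add]; ring
    _ = _ := by rw [hU, hV]

/-- The number of columns in which the rows `x` and `y` of `M` differ. -/
noncomputable def rowDist {α C : Type*} (M : α → C → Fin 2) (x y : α) : ℕ :=
  {c | M x c ≠ M y c}.ncard

/-- The copies of `A` in `M` up to the order of the rows. -/
def patternSet {α C : Type*} [LT C] {s t : ℕ} (A : Matrix (Fin s) (Fin t) (Fin 2))
    (M : α → C → Fin 2) : Set ((Fin s → α) × (Fin t → C)) :=
  {p | Function.Injective p.1 ∧ (∀ ⦃b b'⦄, b < b' → p.2 b < p.2 b') ∧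
    ∀ a b, M (p.1 a) (p.2 b) = A a b}

/-- The number of copies of `A` in `M` up to the order of the rows. -/
noncomputable def patternCount {α C : Type*} [LT C] {s t : ℕ}
    (A : Matrix (Fin s) (Fin t) (Fin 2)) (M : α → C → Fin 2) : ℕ :=
  (patternSet A M).ncard

theorem ncard_forall_agree {α : Type*} {n : ℕ} (M : α → Fin n → Fin 2) (x y : α) (q : ℕ) :
    {f : Fin q → Fin n | ∀ j, M x (f j) = M y (f j)}.ncard = (n - rowDist M x y) ^ q := by
  classical
  have h1 : {f : Fin q → Fin n | ∀ j, M x (f j) = M y (f j)} =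
      (Fintype.piFinset fun _ : Fin q => Finset.univ.filter fun c => M x c = M y c :
        Finset (Fin q → Fin n)) := by
    ext f; simp
  rw [h1, Set.ncard_coe_finset, Fintype.card_piFinset, Finset.prod_const, Finset.card_univ,
    Fintype.card_fin]
  congr 1
  have h2 := Set.ncard_add_ncard_compl {c | M x c ≠ M y c}
  have h3 : {c | M x c ≠ M y c}ᶜ = (Finset.univ.filter fun c => M x c = M y c : Finset _) := by
    ext; simp
  rw [h3, Set.ncard_coe_finset, Nat.card_fin] at h2
  unfold rowDist
  omega

theorem ncard_sigma_le {X Y : Type*} [Finite X] [Finite Y] (P : Set (X × Y)) (u : ℝ)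
    (h : ∀ x, ({y | (x, y) ∈ P}.ncard : ℝ) ≤ u) : (P.ncard : ℝ) ≤ Nat.card X * u := by
  classical
  have := Fintype.ofFinite X
  have hP : P = ⋃ x, (Prod.mk x) '' {y | (x, y) ∈ P} := by
    ext ⟨x, y⟩; simp
  have h1 : P.ncard ≤ ∑ x, {y | (x, y) ∈ P}.ncard := by
    conv_lhs => rw [hP]
    refine (Set.ncard_iUnion_le_of_fintype _).trans (Finset.sum_le_sum fun x _ => ?_)
    exact Set.ncard_image_le
  calc (P.ncard : ℝ) ≤ ∑ x, ({y | (x, y) ∈ P}.ncard : ℝ) := by exact_mod_cast h1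
    _ ≤ ∑ _x : X, u := Finset.sum_le_sum fun x _ => h x
    _ = _ := by simp

/-- Either the rows sampled at `i` and `i'` are close (equal rows included), or they differ in more
than `β * n` columns and `q` independent columns all miss the difference. -/
theorem ncard_indistinct_le {α : Type*} [Fintype α] {n m q : ℕ}
    (M : α → Fin n → Fin 2) {β γ : ℝ} (hβ1 : β ≤ 1)
    (hγ : ({p : α × α | (rowDist M p.1 p.2 : ℝ) ≤ β * n}.ncard : ℝ)
      ≤ γ * (Fintype.card α : ℝ) ^ 2) (hα : 0 < Fintype.card α) {i i' : Fin m} (hi : i ≠ i') :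
    ({p : (Fin m → α) × (Fin q → Fin n) | ∀ j, M (p.1 i) (p.2 j) = M (p.1 i') (p.2 j)}.ncard : ℝ)
      ≤ (γ + (1 - β) ^ q) * ((Fintype.card α : ℝ) ^ m * (n : ℝ) ^ q) := by
  classical
  let close : Set (α × α) := {p | (rowDist M p.1 p.2 : ℝ) ≤ β * n}
  let P1 : Set ((Fin m → α) × (Fin q → Fin n)) := {p | (p.1 i, p.1 i') ∈ close}
  let P2 : Set ((Fin m → α) × (Fin q → Fin n)) := {p | (p.1 i, p.1 i') ∉ close ∧
    ∀ j, M (p.1 i) (p.2 j) = M (p.1 i') (p.2 j)}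
  have hsub : {p : (Fin m → α) × (Fin q → Fin n) |
      ∀ j, M (p.1 i) (p.2 j) = M (p.1 i') (p.2 j)} ⊆ P1 ∪ P2 := by
    intro p hp
    by_cases h : (p.1 i, p.1 i') ∈ close
    · exact Or.inl h
    · exact Or.inr ⟨h, hp⟩
  have h1 : (P1.ncard : ℝ) ≤ γ * ((Fintype.card α : ℝ) ^ m * (n : ℝ) ^ q) := by
    have hinj : Function.Injective ![i, i'] := by
      intro a b; fin_cases a <;> fin_cases b <;> simp [hi, hi.symm]
    have h := card_comp_mem_mul_le ![i, i'] hinj (Fin.elim0 : Fin 0 → Fin q)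
      (fun a => a.elim0) ({p | (p.1 0, p.1 1) ∈ close} : Set ((Fin 2 → α) × (Fin 0 → Fin n)))
    have hc : ({p | (p.1 0, p.1 1) ∈ close} : Set ((Fin 2 → α) × (Fin 0 → Fin n))).ncard ≤
        close.ncard := by
      apply Set.ncard_le_ncard_of_injOn (fun p => (p.1 0, p.1 1))
      · intro p hp; exact hp
      · rintro ⟨a, b⟩ - ⟨a', b'⟩ - h
        simp only [Prod.mk.injEq] at h
        refine Prod.ext ?_ (funext fun z => z.elim0)
        funext z; fin_cases z
        · exact h.1
        · exact h.2
    have h' := h.trans (Nat.mul_le_mul_right _ hc)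
    simp only [Function.comp, Set.mem_ofPred_eq, Matrix.cons_val_zero, Matrix.cons_val_one,
      pow_zero, mul_one, Fintype.card_fin] at h'
    have h'' : (P1.ncard : ℝ) * (Fintype.card α : ℝ) ^ 2 ≤
        close.ncard * ((Fintype.card α : ℝ) ^ m * (n : ℝ) ^ q) := by exact_mod_cast h'
    have hpos : (0 : ℝ) < (Fintype.card α : ℝ) ^ 2 := by positivity
    refine le_of_mul_le_mul_right (h''.trans ?_) hpos
    calc _ ≤ γ * (Fintype.card α : ℝ) ^ 2 * ((Fintype.card α : ℝ) ^ m * (n : ℝ) ^ q) :=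
          mul_le_mul_of_nonneg_right hγ (by positivity)
      _ = _ := by ring
  have h2 : (P2.ncard : ℝ) ≤ (1 - β) ^ q * ((Fintype.card α : ℝ) ^ m * (n : ℝ) ^ q) := by
    refine (ncard_sigma_le P2 ((1 - β) ^ q * (n : ℝ) ^ q) fun x => ?_).trans (le_of_eq ?_)
    · by_cases hx : (x i, x i') ∈ close
      · have : {y | (x, y) ∈ P2} = ∅ := by ext y; simp [P2, hx]
        rw [this]
        simp only [Set.ncard_empty, Nat.cast_zero]
        have : 0 ≤ 1 - β := by linarith
        positivity
      · have h3 : {y | (x, y) ∈ P2} = {y | ∀ j, M (x i) (y j) = M (x i') (y j)} := by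
          ext y; simp [P2, hx]
        rw [h3, ncard_forall_agree, Nat.cast_pow, ← mul_pow]
        have h4 : rowDist M (x i) (x i') ≤ n := by
          unfold rowDist
          exact (Set.ncard_le_card _).trans (by simp)
        rw [Nat.cast_sub h4]
        apply pow_le_pow_left₀
        · rw [sub_nonneg]; exact_mod_cast h4
        · simp only [close, Set.mem_ofPred_eq, not_le] at hx
          linarith
    · simp; ring
  have h3 : ({p : (Fin m → α) × (Fin q → Fin n) |
      ∀ j, M (p.1 i) (p.2 j) = M (p.1 i') (p.2 j)}.ncard : ℝ) ≤ P1.ncard + P2.ncard := by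
    exact_mod_cast (Set.ncard_le_ncard hsub).trans (Set.ncard_union_le _ _)
  linarith

/-- If few pairs of rows of `M` are close to each other, then `M` contains many copies of every
fixed matrix, up to the order of its rows. -/
theorem patternCount_of_few_close {α : Type*} [Fintype α] {n m q s t : ℕ} (hn : 0 < n)
    (hq : 0 < q) (hm : (t + s + 1) * q ^ (t + s) < m)
    (M : α → Fin n → Fin 2) {β γ : ℝ} (hβ1 : β ≤ 1)
    (hγ : ({p : α × α | (rowDist M p.1 p.2 : ℝ) ≤ β * n}.ncard : ℝ)
      ≤ γ * (Fintype.card α : ℝ) ^ 2) (hα : 0 < Fintype.card α) (hγ0 : 0 ≤ γ)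
    (hmq : (m : ℝ) ^ 2 * (γ + (1 - β) ^ q) ≤ 1 / 2) (A : Matrix (Fin s) (Fin t) (Fin 2)) :
    (Fintype.card α : ℝ) ^ s * (n : ℝ) ^ t ≤ 2 * (m : ℝ) ^ s * (q : ℝ) ^ t * patternCount A M := by
  classical
  set N : ℝ := (Fintype.card α : ℝ) ^ m * (n : ℝ) ^ q with hN
  have hN0 : 0 < N := by positivity
  let bad : Fin m × Fin m → Set ((Fin m → α) × (Fin q → Fin n)) := fun r =>
    {p | r.1 ≠ r.2 ∧ ∀ j, M (p.1 r.1) (p.2 j) = M (p.1 r.2) (p.2 j)}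
  let good : (Fin s → Fin m) × (Fin t → Fin q) → Set ((Fin m → α) × (Fin q → Fin n)) := fun r =>
    {p | (p.1 ∘ r.1, p.2 ∘ r.2) ∈ patternSet A M}
  -- Union bound over the `m ^ 2` pairs of positions: at least half of the `N` samples avoid `bad`,
  -- so contain `A` at one of `m ^ s * q ^ t` position pairs; averaging then bounds the count.
  have hcover : (Set.univ : Set ((Fin m → α) × (Fin q → Fin n))) ⊆ (⋃ r, bad r) ∪ ⋃ r, good r := by
    rintro ⟨x, y⟩ -
    by_cases h : Function.Injective fun i j => M (x i) (y j)
    · obtain ⟨i, j, h1, h2, h3⟩ := exists_pattern M hq hm x y h A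
      exact Or.inr (Set.mem_iUnion.2 ⟨(i, j), h1, h2, h3⟩)
    · rw [Function.not_injective_iff] at h
      obtain ⟨i, i', h1, h2⟩ := h
      exact Or.inl (Set.mem_iUnion.2 ⟨(i, i'), h2, fun j => congrFun h1 j⟩)
  have hbad : ∀ r, ((bad r).ncard : ℝ) ≤ (γ + (1 - β) ^ q) * N := by
    rintro ⟨i, i'⟩
    by_cases h : i = i'
    · have : bad (i, i') = ∅ := by ext; simp [bad, h]
      rw [this]
      have : 0 ≤ 1 - β := by linarith
      simp only [Set.ncard_empty, Nat.cast_zero]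
      positivity
    · have : bad (i, i') = {p | ∀ j, M (p.1 i) (p.2 j) = M (p.1 i') (p.2 j)} := by
        ext; simp [bad, h]
      rw [this]
      exact ncard_indistinct_le M hβ1 hγ hα h
  have hgood : ∀ r, ((good r).ncard : ℝ) * ((Fintype.card α : ℝ) ^ s * (n : ℝ) ^ t) ≤
      patternCount A M * N := by
    rintro ⟨i, j⟩
    by_cases h : Function.Injective i ∧ Function.Injective j
    · have := card_comp_mem_mul_le i h.1 j h.2 (patternSet A M)
      rw [Fintype.card_fin] at this
      rw [hN]
      exact_mod_cast this
    · have : good (i, j) = ∅ := by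
        ext p
        simp only [good, Set.mem_ofPred_eq, Set.mem_empty_iff_false, iff_false]
        intro hp
        have h1 : Function.Injective (p.1 ∘ i) := hp.1
        refine h ⟨h1.of_comp, ?_⟩
        have : StrictMono (p.2 ∘ j) := hp.2.1
        exact this.injective.of_comp
      rw [this]
      simp only [Set.ncard_empty, Nat.cast_zero, zero_mul]
      positivity
  have hB : ((⋃ r, bad r).ncard : ℝ) ≤ N / 2 := by
    calc ((⋃ r, bad r).ncard : ℝ) ≤ ∑ r, ((bad r).ncard : ℝ) := by
          exact_mod_cast Set.ncard_iUnion_le_of_fintype _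
      _ ≤ ∑ _r : Fin m × Fin m, (γ + (1 - β) ^ q) * N := Finset.sum_le_sum fun r _ => hbad r
      _ = ((m : ℝ) ^ 2 * (γ + (1 - β) ^ q)) * N := by simp; ring
      _ ≤ 1 / 2 * N := mul_le_mul_of_nonneg_right hmq hN0.le
      _ = N / 2 := by ring
  have htot : N ≤ (⋃ r, bad r).ncard + (⋃ r, good r).ncard := by
    have h := (Set.ncard_le_ncard hcover).trans (Set.ncard_union_le _ _)
    rw [Set.ncard_univ] at h
    simp only [Nat.card_eq_fintype_card, Fintype.card_prod, Fintype.card_fun,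
      Fintype.card_fin] at h
    rw [hN]
    exact_mod_cast h
  have hG : ((⋃ r, good r).ncard : ℝ) * ((Fintype.card α : ℝ) ^ s * (n : ℝ) ^ t) ≤
      (m : ℝ) ^ s * (q : ℝ) ^ t * (patternCount A M * N) := by
    calc _ ≤ (∑ r, ((good r).ncard : ℝ)) * ((Fintype.card α : ℝ) ^ s * (n : ℝ) ^ t) := by
          apply mul_le_mul_of_nonneg_right _ (by positivity)
          exact_mod_cast Set.ncard_iUnion_le_of_fintype _
      _ = ∑ r, ((good r).ncard : ℝ) * ((Fintype.card α : ℝ) ^ s * (n : ℝ) ^ t) := by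
          rw [Finset.sum_mul]
      _ ≤ ∑ _r : (Fin s → Fin m) × (Fin t → Fin q), patternCount A M * N :=
          Finset.sum_le_sum fun r _ => hgood r
      _ = _ := by simp
  have hG' : N / 2 ≤ (⋃ r, good r).ncard := by linarith
  have h5 := (mul_le_mul_of_nonneg_right hG'
    (show 0 ≤ (Fintype.card α : ℝ) ^ s * (n : ℝ) ^ t by positivity)).trans hG
  refine le_of_mul_le_mul_left ?_ hN0
  linarith

/-- Take `q` of order `β ^ (-N)` and `m` of order `q ^ K`. Since `(1 - β) ^ q ≤ exp (-β q) ≤ N! / (β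
q) ^ N`, the exponent `N = 2K + 1` beats `m ^ 2` by one factor `q`, which `C` makes large enough. -/
theorem exists_sample_sizes (K : ℕ) : ∃ c : ℝ, 0 < c ∧ c ≤ 1 ∧ ∃ D : ℕ, ∀ β : ℝ, 0 < β → β ≤ 1 →
    ∃ m q : ℕ, 0 < q ∧ (K + 1) * q ^ K < m ∧ (m : ℝ) ^ 2 * (1 - β) ^ q ≤ 1 / 4 ∧
      (m : ℝ) * (c * β ^ D) ≤ 1 ∧ (q : ℝ) * (c * β ^ D) ≤ 1 := by
  set N := 2 * K + 1 with hN
  set C : ℕ := 4 * (K + 2) ^ 2 * N.factorial with hC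
  have hC1 : 1 ≤ C := Nat.one_le_iff_ne_zero.2 (by positivity)
  have hC1' : (1 : ℝ) ≤ C := by exact_mod_cast hC1
  refine ⟨1 / ((K + 2) * (2 * C) ^ (K + 1)), by positivity, ?_, N * (K + 1), ?_⟩
  · rw [div_le_one (by positivity)]
    have h1 : (1 : ℝ) ≤ (2 * C) ^ (K + 1) := one_le_pow₀ (by linarith)
    have h2 : (1 : ℝ) ≤ (K : ℝ) + 2 := by
      have : (0 : ℝ) ≤ K := by positivity
      linarith
    nlinarith
  intro β hβ hβ1
  set q := ⌈(C : ℝ) / β ^ N⌉₊ with hq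
  have hβN : 0 < β ^ N := by positivity
  have hβN1 : β ^ N ≤ 1 := pow_le_one₀ hβ.le hβ1
  have hCβ : 1 ≤ (C : ℝ) / β ^ N := by rw [le_div_iff₀ hβN]; linarith
  have hq1 : (C : ℝ) / β ^ N ≤ q := Nat.le_ceil _
  have hq2 : (q : ℝ) ≤ 2 * C / β ^ N := by
    have := (Nat.ceil_lt_add_one (zero_le_one.trans hCβ)).le
    rw [mul_div_assoc]
    linarith
  have hq2' : (q : ℝ) * β ^ N ≤ 2 * C := by rwa [le_div_iff₀ hβN] at hq2
  have hq0 : (1 : ℝ) ≤ q := hCβ.trans hq1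
  have hm : (((K + 1) * q ^ K + 1 : ℕ) : ℝ) ≤ (K + 2) * (q : ℝ) ^ K := by
    have : (1 : ℝ) ≤ (q : ℝ) ^ K := one_le_pow₀ hq0
    push_cast
    linarith
  refine ⟨(K + 1) * q ^ K + 1, q, by exact_mod_cast hq0, Nat.lt_succ_self _, ?_, ?_, ?_⟩
  · have h1 : (1 - β) ^ q ≤ Real.exp (-(β * q)) := by
      calc (1 - β) ^ q ≤ Real.exp (-β) ^ q :=
            pow_le_pow_left₀ (by linarith) (Real.one_sub_le_exp_neg β) q
        _ = _ := by rw [← Real.exp_nat_mul]; congr 1; ring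
    have h2 : (1 - β) ^ q * (β * q) ^ N ≤ N.factorial := by
      have h3 := Real.pow_div_factorial_le_exp (β * q) (by positivity) N
      rw [div_le_iff₀ (by positivity)] at h3
      calc (1 - β) ^ q * (β * q) ^ N
          ≤ Real.exp (-(β * q)) * (Real.exp (β * q) * N.factorial) :=
            mul_le_mul h1 h3 (by positivity) (Real.exp_pos _).le
        _ = N.factorial := by rw [← mul_assoc, ← Real.exp_add]; simp
    have h0 : 0 ≤ (1 - β) ^ q := pow_nonneg (by linarith) _
    have h4 : (((K + 1) * q ^ K + 1 : ℕ) : ℝ) ^ 2 * (1 - β) ^ q * (β ^ N * q) ≤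
        (K + 2) ^ 2 * N.factorial := by
      calc _ ≤ ((K + 2) * (q : ℝ) ^ K) ^ 2 * (1 - β) ^ q * (β ^ N * q) := by gcongr
        _ = (K + 2) ^ 2 * ((1 - β) ^ q * (β * q) ^ N) := by rw [hN]; ring
        _ ≤ _ := by gcongr
    have h5 : 4 * ((K : ℝ) + 2) ^ 2 * N.factorial ≤ β ^ N * q := by
      rw [div_le_iff₀ hβN, hC] at hq1
      push_cast at hq1
      linarith
    have hY : 0 < β ^ N * q := by positivity
    refine le_of_mul_le_mul_right (h4.trans ?_) hY
    linarith
  · calc _ ≤ (K + 2) * (q : ℝ) ^ K * (1 / ((K + 2) * (2 * C) ^ (K + 1)) * β ^ (N * (K + 1))) := by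
          gcongr
      _ = ((q : ℝ) * β ^ N) ^ K * β ^ N / (2 * C) ^ (K + 1) := by
          field_simp; ring
      _ ≤ (2 * C) ^ K * 1 / (2 * C) ^ (K + 1) := by gcongr
      _ ≤ 1 := by
          rw [div_le_one (by positivity), mul_one]
          exact pow_le_pow_right₀ (by linarith) (Nat.le_succ K)
  · calc (q : ℝ) * (1 / ((K + 2) * (2 * C) ^ (K + 1)) * β ^ (N * (K + 1)))
        = ((q : ℝ) * β ^ N) * (β ^ N) ^ K / ((K + 2) * (2 * C) ^ (K + 1)) := by
          field_simp; ring
      _ ≤ (2 * C) * 1 / (1 * (2 * C) ^ (K + 1)) := by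
          gcongr
          · exact pow_le_one₀ hβN.le hβN1
          · have : (0 : ℝ) ≤ K := by positivity
            linarith
      _ ≤ 1 := by
          rw [div_le_one (by positivity), mul_one, one_mul]
          exact le_self_pow₀ (by linarith) (Nat.succ_ne_zero K)

theorem patternCount_restrict_le {α C : Type*} [Finite α] [Finite C] [LT C] {s t : ℕ}
    (A : Matrix (Fin s) (Fin t) (Fin 2)) (M : α → C → Fin 2) (X : Finset α) :
    patternCount A (fun x : X => M x) ≤ patternCount A M := by
  apply Set.ncard_le_ncard_of_injOn (fun p => (fun a => (p.1 a : α), p.2))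
  · rintro ⟨x, y⟩ ⟨h1, h2, h3⟩
    exact ⟨Subtype.val_injective.comp h1, h2, h3⟩
  · rintro ⟨x, y⟩ - ⟨x', y'⟩ - h
    simp only [Prod.mk.injEq] at h
    refine Prod.ext (funext fun a => Subtype.ext (congrFun h.1 a)) h.2

/-- If many rows of `M` have only few rows close to them, then `M` contains many copies of every
fixed matrix, up to the order of its rows. -/
theorem exists_patternCount_bound (s t : ℕ) : ∃ c : ℝ, 0 < c ∧ c ≤ 1 ∧ ∃ D : ℕ, 1 ≤ D ∧
    ∀ β : ℝ, 0 < β → β ≤ 1 → ∀ n : ℕ, 0 < n → ∀ (M : Fin n → Fin n → Fin 2) (X : Finset (Fin n)),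
      β * n ≤ X.card →
      (∀ x ∈ X, ({y | (rowDist M x y : ℝ) ≤ β * n}.ncard : ℝ) ≤ c * β ^ D * n) →
      ∀ A : Matrix (Fin s) (Fin t) (Fin 2), c * β ^ D * (n : ℝ) ^ (s + t) ≤ patternCount A M := by
  obtain ⟨c, hc, hc1, D, h⟩ := exists_sample_sizes (t + s)
  -- `c ^ 2 / 4` and `2 * D + 1` make close pairs a fraction at most `1 / (4 * m ^ 2)` inside `X`;
  -- `s` comes from `X.card ≥ β * n`, and `D * (s + t)` from `m ^ s * q ^ t`.
  refine ⟨c ^ (2 + s + t) / 4, by positivity, ?_, 2 * D + 1 + s + D * (s + t), by omega, ?_⟩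
  · have : c ^ (2 + s + t) ≤ 1 := pow_le_one₀ hc.le hc1
    linarith
  intro β hβ hβ1 n hn M X hX hclose A
  obtain ⟨m, q, hq, hm, hmq, hcm, hcq⟩ := h β hβ hβ1
  have hn' : (0 : ℝ) < n := by exact_mod_cast hn
  have hm0 : (0 : ℝ) < m := by exact_mod_cast (Nat.zero_le _).trans_lt hm
  have hq0 : (0 : ℝ) < q := by exact_mod_cast hq
  have hX0 : (0 : ℝ) < X.card := lt_of_lt_of_le (by positivity) hX
  have hcard : Fintype.card X = X.card := Fintype.card_coe X
  have hcount := patternCount_of_few_close hn hq hm (fun x : X => M x) (γ := 1 / (4 * m ^ 2)) hβ1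
    ?_ (by rw [hcard]; exact_mod_cast hX0) (by positivity) ?_ A
  · have h1 : (patternCount A (fun x : X => M x) : ℝ) ≤ patternCount A M := by
      exact_mod_cast patternCount_restrict_le A M X
    rw [hcard] at hcount
    have h2 : (β * n) ^ s * (n : ℝ) ^ t ≤ 2 * (m : ℝ) ^ s * (q : ℝ) ^ t * patternCount A M := by
      calc _ ≤ (X.card : ℝ) ^ s * (n : ℝ) ^ t := by gcongr
        _ ≤ _ := hcount.trans (by gcongr)
    calc c ^ (2 + s + t) / 4 * β ^ (2 * D + 1 + s + D * (s + t)) * (n : ℝ) ^ (s + t)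
        = (c ^ 2 * β ^ (2 * D + 1) / 4) * (c * β ^ D) ^ (s + t) * ((β * n) ^ s * (n : ℝ) ^ t) := by
          ring
      _ ≤ (1 / 2) * (c * β ^ D) ^ (s + t) *
          (2 * (m : ℝ) ^ s * (q : ℝ) ^ t * patternCount A M) := by
          gcongr ?_ * _ * ?_
          have h3 : c ^ 2 ≤ 1 := pow_le_one₀ hc.le hc1
          have h4 : β ^ (2 * D + 1) ≤ 1 := pow_le_one₀ hβ.le hβ1
          have h5 : c ^ 2 * β ^ (2 * D + 1) ≤ 1 := mul_le_one₀ h3 (by positivity) h4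
          linarith
      _ = (m * (c * β ^ D)) ^ s * (q * (c * β ^ D)) ^ t * patternCount A M := by ring
      _ ≤ 1 * 1 * patternCount A M := by
          gcongr
          · exact pow_le_one₀ (by positivity) hcm
          · exact pow_le_one₀ (by positivity) hcq
      _ = _ := by ring
  · have h1 := ncard_sigma_le {p : X × X | (rowDist (fun x : X => M x) p.1 p.2 : ℝ) ≤ β * n}
      (c ^ (2 + s + t) / 4 * β ^ (2 * D + 1 + s + D * (s + t)) * n) fun x => by
        refine le_trans ?_ (hclose x x.2)
        norm_cast
        apply Set.ncard_le_ncard_of_injOn (fun y : X => (y : Fin n))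
        · intro y hy; exact hy
        · exact Subtype.val_injective.injOn
    refine h1.trans ?_
    rw [Nat.card_eq_fintype_card, hcard]
    have h2 : c ^ (2 + s + t) ≤ c ^ 2 := pow_le_pow_of_le_one hc.le hc1 (by omega)
    have h3 : β ^ (2 * D + 1 + s + D * (s + t)) ≤ β ^ (2 * D + 1) :=
      pow_le_pow_of_le_one hβ.le hβ1 (by rw [add_assoc]; exact Nat.le_add_right _ _)
    calc (X.card : ℝ) * (c ^ (2 + s + t) / 4 * β ^ (2 * D + 1 + s + D * (s + t)) * n)
        ≤ (X.card : ℝ) * (c ^ 2 / 4 * β ^ (2 * D + 1) * n) := by gcongr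
      _ = (c * β ^ D) ^ 2 / 4 * (β * n) * X.card := by ring
      _ ≤ (1 / m) ^ 2 / 4 * X.card * X.card := by
          gcongr
          rw [le_div_iff₀ hm0]
          linarith
      _ = _ := by field_simp
  · calc (m : ℝ) ^ 2 * (1 / (4 * m ^ 2) + (1 - β) ^ q) = 1 / 4 + (m : ℝ) ^ 2 * (1 - β) ^ q := by
          field_simp
      _ ≤ 1 / 2 := by linarith

/-! ### Ordered column blocks and deletion of columns -/

/-- Either the letters `0, …, t - 1` occur often and in this order, or few positions meet all
their weakly ordered occurrences. -/
theorem exists_blocks_or_hitting {C : Type*} [LinearOrder C] [Fintype C] (m : ℕ) :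
    ∀ (t : ℕ) (P : Fin t → C → Prop),
      (∃ S : Fin t → Finset C, (∀ b, (S b).card = m) ∧ (∀ b, ∀ c ∈ S b, P b c) ∧
        ∀ b b', b < b' → ∀ c ∈ S b, ∀ c' ∈ S b', c < c') ∨
      ∃ Z : Finset C, Z.card ≤ t * m ∧
        ∀ q : Fin t → C, Monotone q → (∀ b, P b (q b)) → ∃ b, q b ∈ Z := by
  classical
  intro t
  induction t with
  | zero => exact fun P => Or.inl ⟨fun b => b.elim0, fun b => b.elim0, fun b => b.elim0,
      fun b => b.elim0⟩
  | succ t ih =>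
    intro P
    let O : Finset C := Finset.univ.filter (P 0)
    by_cases hO : O.card < m
    · refine Or.inr ⟨O, hO.le.trans (Nat.le_mul_of_pos_left m t.succ_pos), fun q _ hP => ⟨0, ?_⟩⟩
      simpa [O] using hP 0
    push Not at hO
    -- the first `m` occurrences of the letter `0`
    obtain ⟨S₀, hS₀, hS₀m, hS₀i⟩ : ∃ S₀ ⊆ O, S₀.card = m ∧ ∀ c ∈ S₀, ∀ d ∈ O, d ∉ S₀ → c < d := by
      clear ih
      have : ∀ k ≤ O.card, ∃ S₀ ⊆ O, S₀.card = k ∧ ∀ c ∈ S₀, ∀ d ∈ O, d ∉ S₀ → c < d := by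
        intro k
        induction k with
        | zero => exact fun _ => ⟨∅, by simp⟩
        | succ k ihk =>
          intro hk
          obtain ⟨S, hS, hSk, hSi⟩ := ihk (by omega)
          have hne : (O \ S).Nonempty := by
            rw [← Finset.card_pos, Finset.card_sdiff_of_subset hS]; omega
          have hmem := Finset.mem_sdiff.1 ((O \ S).min'_mem hne)
          refine ⟨insert ((O \ S).min' hne) S, Finset.insert_subset hmem.1 hS, ?_, ?_⟩
          · rw [Finset.card_insert_of_notMem hmem.2, hSk]
          · intro c hc d hd hdS
            rw [Finset.mem_insert, not_or] at hdS
            rcases Finset.mem_insert.1 hc with rfl | hc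
            · exact lt_of_le_of_ne (Finset.min'_le _ _ (Finset.mem_sdiff.2 ⟨hd, hdS.2⟩))
                (Ne.symm hdS.1)
            · exact hSi c hc d hd hdS.2
      exact this m hO
    rcases ih (fun b c => P b.succ c ∧ ∀ d ∈ S₀, d < c) with ⟨S, h1, h2, h3⟩ | ⟨Z, hZ, hZ'⟩
    · refine Or.inl ⟨Fin.cons S₀ S, ?_, ?_, ?_⟩
      · intro b
        cases b using Fin.cases with
        | zero => exact hS₀m
        | succ b => exact h1 b
      · intro b
        cases b using Fin.cases with
        | zero => intro c hc; exact (Finset.mem_filter.1 (hS₀ hc)).2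
        | succ b => exact fun c hc => (h2 b c hc).1
      · intro b b' hbb'
        cases b' using Fin.cases with
        | zero => exact absurd hbb' (Fin.not_lt_zero b)
        | succ b' =>
          cases b using Fin.cases with
          | zero => exact fun c hc c' hc' => (h2 b' c' hc').2 c hc
          | succ b => exact h3 b b' (Fin.succ_lt_succ_iff.1 hbb')
    · refine Or.inr ⟨S₀ ∪ Z, ?_, ?_⟩
      · calc _ ≤ S₀.card + Z.card := Finset.card_union_le _ _
          _ ≤ m + t * m := by omega
          _ = (t + 1) * m := by ring
      · intro q hq hP
        by_cases h0 : q 0 ∈ S₀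
        · exact ⟨0, Finset.mem_union_left _ h0⟩
        · obtain ⟨b, hb⟩ := hZ' (fun b => q b.succ)
            (fun b b' h => hq (Fin.succ_le_succ_iff.2 h)) fun b => ⟨hP _, fun d hd =>
              (hS₀i d hd (q 0) (by simpa [O] using hP 0) h0).trans_le (hq (Fin.zero_le _))⟩
          exact ⟨b.succ, Finset.mem_union_right _ hb⟩

/-- Each point goes to the largest point outside `Z` not exceeding it, or to the least point outside
`Z` if there is none. Columns may merge, which is why hitting sets must meet weakly ordered
occurrences. -/
theorem exists_monotone_retraction {C : Type*} [LinearOrder C] (Z : Finset C) [Fintype C]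
    (hZ : Z ≠ Finset.univ) : ∃ φ : C → C, Monotone φ ∧ (∀ c, φ c ∉ Z) ∧ ∀ c ∉ Z, φ c = c := by
  classical
  have hK : (Zᶜ).Nonempty := by rwa [Finset.nonempty_iff_ne_empty, Ne, Finset.compl_eq_empty_iff]
  let K : C → Finset C := fun c => insert ((Zᶜ).min' hK) ((Zᶜ).filter (· ≤ c))
  have hKne : ∀ c, (K c).Nonempty := fun c => Finset.insert_nonempty _ _
  have hKZ : ∀ c, ∀ d ∈ K c, d ∈ Zᶜ := by
    intro c d hd
    rcases Finset.mem_insert.1 hd with rfl | hd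
    · exact Finset.min'_mem _ _
    · exact (Finset.mem_filter.1 hd).1
  refine ⟨fun c => (K c).max' (hKne c), ?_, ?_, ?_⟩
  · intro c c' h
    apply Finset.max'_subset
    exact Finset.insert_subset_insert _ fun d hd => by
      rw [Finset.mem_filter] at hd ⊢
      exact ⟨hd.1, hd.2.trans h⟩
  · intro c
    exact Finset.mem_compl.1 (hKZ c _ (Finset.max'_mem _ _))
  · intro c hc
    have hc' : c ∈ Zᶜ := Finset.mem_compl.2 hc
    apply le_antisymm
    · refine Finset.max'_le _ _ _ fun d hd => ?_
      rcases Finset.mem_insert.1 hd with rfl | hd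
      · exact Finset.min'_le _ _ hc'
      · exact (Finset.mem_filter.1 hd).2
    · exact Finset.le_max' (K c) c
        (Finset.mem_insert_of_mem (Finset.mem_filter.2 ⟨hc', le_rfl⟩))

/-! ### Sorting the rows of a pattern -/

theorem exists_orderEmbedding_comp_perm {s n : ℕ} (x : Fin s → Fin n)
    (hx : Function.Injective x) :
    ∃ (e : Fin s ↪o Fin n) (σ : Equiv.Perm (Fin s)), ∀ a, x (σ a) = e a := by
  refine ⟨OrderEmbedding.ofStrictMono (x ∘ Tuple.sort x) ?_, Tuple.sort x, fun a => rfl⟩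
  exact (Tuple.monotone_sort x).strictMono_of_injective (hx.comp (Tuple.sort x).injective)

theorem patternCount_le_sum_numCopies {s t n : ℕ} (A : Matrix (Fin s) (Fin t) (Fin 2))
    (M : Matrix (Fin n) (Fin n) (Fin 2)) :
    patternCount A M ≤ ∑ σ : Equiv.Perm (Fin s), numCopies (A.submatrix σ id) M := by
  classical
  let f : Equiv.Perm (Fin s) → ((Fin s ↪o Fin n) × (Fin t ↪o Fin n)) →
      (Fin s → Fin n) × (Fin t → Fin n) := fun σ e => (fun a => e.1 (σ.symm a), e.2)
  have h : patternSet A M ⊆ ⋃ σ : Equiv.Perm (Fin s),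
      f σ '' matrixCopies (A.submatrix σ id) M := by
    rintro ⟨x, y⟩ ⟨h1, h2, h3⟩
    obtain ⟨e, σ, he⟩ := exists_orderEmbedding_comp_perm x h1
    refine Set.mem_iUnion.2 ⟨σ, (e, OrderEmbedding.ofStrictMono y h2), ?_, ?_⟩
    · refine Matrix.ext fun a b => ?_
      have h4 : M (x (σ a)) (y b) = A (σ a) b := h3 (σ a) b
      rw [he] at h4
      exact h4
    · refine Prod.ext (funext fun a => ?_) rfl
      simp only [f]
      rw [← he, Equiv.apply_symm_apply]
  calc patternCount A M ≤ (⋃ σ : Equiv.Perm (Fin s),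
        f σ '' matrixCopies (A.submatrix σ id) M).ncard :=
        Set.ncard_le_ncard h (Set.toFinite _)
    _ ≤ ∑ σ : Equiv.Perm (Fin s), (f σ '' matrixCopies (A.submatrix σ id) M).ncard :=
        Set.ncard_iUnion_le_of_fintype _
    _ ≤ _ := Finset.sum_le_sum fun σ _ => Set.ncard_image_le (matrixCopies_finite _ _)

/-! ### Row distance, nets and counting inside blocks -/

theorem rowDist_comm {α C : Type*} (M : α → C → Fin 2) (x y : α) :
    rowDist M x y = rowDist M y x := by
  unfold rowDist
  congr 1
  ext c
  exact ne_comm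

theorem rowDist_triangle {α C : Type*} [Finite C] (M : α → C → Fin 2) (x y z : α) :
    rowDist M x z ≤ rowDist M x y + rowDist M y z := by
  unfold rowDist
  refine (Set.ncard_le_ncard ?_).trans (Set.ncard_union_le _ _)
  intro c hc
  by_cases h : M x c = M y c
  · exact Or.inr fun h' => hc (h.trans h')
  · exact Or.inl h

/-- Rows all of which have many rows close to them have a small net. -/
theorem exists_small_net {n : ℕ} (M : Fin n → Fin n → Fin 2) {r γ : ℝ} (hn : 0 < n) (hr : 0 ≤ r)
    (G : Finset (Fin n)) (hG : ∀ x ∈ G, γ * n ≤ ({y | (rowDist M x y : ℝ) ≤ r}.ncard : ℝ)) :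
    ∃ T ⊆ G, (T.card : ℝ) * γ ≤ 1 ∧ ∀ x ∈ G, ∃ y ∈ T, (rowDist M x y : ℝ) ≤ 2 * r := by
  classical
  -- A largest `2r`-separated subset of `G` is a net by maximality; its `r`-balls are disjoint and
  -- have at least `γ * n` rows each.
  let sep : Finset (Finset (Fin n)) := G.powerset.filter fun T =>
    ∀ x ∈ T, ∀ y ∈ T, x ≠ y → 2 * r < rowDist M x y
  obtain ⟨T, hT, hmax⟩ := Finset.exists_max_image sep Finset.card ⟨∅, by simp [sep]⟩
  simp only [sep, Finset.mem_filter, Finset.mem_powerset] at hT hmax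
  refine ⟨T, hT.1, ?_, ?_⟩
  · let B : Fin n → Finset (Fin n) := fun x => Finset.univ.filter fun y => (rowDist M x y : ℝ) ≤ r
    have hB : ∀ x, {y | (rowDist M x y : ℝ) ≤ r}.ncard = (B x).card := by
      intro x
      rw [← Set.ncard_coe_finset]
      congr 1
      ext; simp [B]
    have hdisj : (T : Set (Fin n)).PairwiseDisjoint B := by
      intro x hx y hy hxy
      refine Finset.disjoint_left.2 fun z hz hz' => ?_
      simp only [B, Finset.mem_filter, Finset.mem_univ, true_and] at hz hz'
      have h1 := hT.2 x hx y hy hxy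
      have h2 : (rowDist M x y : ℝ) ≤ rowDist M x z + rowDist M z y := by
        exact_mod_cast rowDist_triangle M x z y
      rw [rowDist_comm M z y] at h2
      linarith
    have h1 : ((T.biUnion B).card : ℝ) ≤ n := by
      exact_mod_cast (Finset.card_le_univ _).trans (by simp)
    rw [Finset.card_biUnion hdisj] at h1
    push_cast at h1
    have h2 : (T.card : ℝ) * (γ * n) ≤ ∑ x ∈ T, ((B x).card : ℝ) := by
      rw [← nsmul_eq_mul]
      exact Finset.card_nsmul_le_sum _ _ _ fun x hx => by
        rw [← hB]; exact hG x (hT.1 hx)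
    have hn' : (0 : ℝ) < n := by exact_mod_cast hn
    refine le_of_mul_le_mul_right ?_ hn'
    linarith
  · intro x hx
    by_contra! hc
    have hxT : x ∉ T := fun h => by
      have h0 : rowDist M x x = 0 := by simp [rowDist]
      have := hc x h
      rw [h0] at this
      push_cast at this
      linarith
    have := hmax (insert x T) ⟨Finset.insert_subset hx hT.1, ?_⟩
    · rw [Finset.card_insert_of_notMem hxT] at this
      omega
    · intro a ha b hb hab
      rcases Finset.mem_insert.1 ha with rfl | ha' <;>
        rcases Finset.mem_insert.1 hb with rfl | hb'
      · exact absurd rfl hab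
      · exact hc b hb'
      · rw [rowDist_comm]; exact hc a ha'
      · exact hT.2 a ha' b hb' hab

/-- Greedy choice. Disjointness makes rows chosen from different sets distinct. -/
theorem exists_disjoint_subsets {α : Type*} [DecidableEq α] (L : ℕ) : ∀ (s : ℕ)
    (B : Fin s → Finset α), (∀ a, s * L ≤ (B a).card) →
    ∃ B' : Fin s → Finset α, (∀ a, B' a ⊆ B a) ∧ (∀ a, (B' a).card = L) ∧
      ∀ a b, a < b → Disjoint (B' a) (B' b) := by
  intro s
  induction s with
  | zero => exact fun B _ => ⟨B, fun a => a.elim0, fun a => a.elim0, fun a => a.elim0⟩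
  | succ s ih =>
    intro B hB
    obtain ⟨B₀, hB₀, hB₀L⟩ := Finset.exists_subset_card_eq
      ((Nat.le_mul_of_pos_left L s.succ_pos).trans (hB 0))
    obtain ⟨B', h1, h2, h3⟩ := ih (fun a => B a.succ \ B₀) fun a => by
      have h4 := Finset.le_card_sdiff B₀ (B a.succ)
      have h5 := hB a.succ
      rw [Nat.succ_mul] at h5
      omega
    refine ⟨Fin.cons B₀ B', ?_, ?_, ?_⟩
    · intro a
      cases a using Fin.cases with
      | zero => exact hB₀
      | succ a => exact (h1 a).trans Finset.sdiff_subset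
    · intro a
      cases a using Fin.cases with
      | zero => exact hB₀L
      | succ a => exact h2 a
    · intro a b hab
      cases b using Fin.cases with
      | zero => exact absurd hab (Fin.not_lt_zero a)
      | succ b =>
        cases a using Fin.cases with
        | zero => exact (Finset.disjoint_sdiff (s := B₀)).mono_right (h1 b)
        | succ a => exact h3 a b (Fin.succ_lt_succ_iff.1 hab)

/-- A copy of `A` in long column blocks, in rows with many rows close to them, yields many copies
of `A` up to the order of the rows. -/
theorem patternCount_of_blocks {n s t m L d : ℕ} (M : Fin n → Fin n → Fin 2)
    (A : Matrix (Fin s) (Fin t) (Fin 2)) (ρ : Fin s → Fin n) (B : Fin s → Finset (Fin n))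
    (hB : ∀ a, ∀ y ∈ B a, rowDist M (ρ a) y ≤ d) (hBL : ∀ a, s * L ≤ (B a).card)
    (S : Fin t → Finset (Fin n)) (hSm : ∀ b, (S b).card = m)
    (hSA : ∀ b, ∀ c ∈ S b, ∀ a, M (ρ a) c = A a b)
    (hS : ∀ b b', b < b' → ∀ c ∈ S b, ∀ c' ∈ S b', c < c') :
    L ^ s * (m - s * d) ^ t ≤ patternCount A M := by
  classical
  obtain ⟨B', h1, h2, h3⟩ := exists_disjoint_subsets L s B hBL
  -- The columns of block `b` on which the exchanged rows `y` still agree with `ρ`; at most `s * d`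
  -- columns are lost.
  let S' : (Fin s → Fin n) → Fin t → Finset (Fin n) := fun y b =>
    (S b).filter fun c => ∀ a, M (y a) c = M (ρ a) c
  have hS' : ∀ y ∈ Fintype.piFinset B', (m - s * d) ^ t ≤ (Fintype.piFinset (S' y)).card := by
    intro y hy
    rw [Fintype.card_piFinset]
    have : ∀ b, m - s * d ≤ (S' y b).card := by
      intro b
      have h4 : S b ⊆ S' y b ∪ Finset.univ.biUnion fun a =>
          Finset.univ.filter fun c => M (ρ a) c ≠ M (y a) c := by
        intro c hc
        by_cases h : ∀ a, M (y a) c = M (ρ a) c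
        · exact Finset.mem_union_left _ (Finset.mem_filter.2 ⟨hc, h⟩)
        · push Not at h
          obtain ⟨a, ha⟩ := h
          exact Finset.mem_union_right _ (Finset.mem_biUnion.2 ⟨a, Finset.mem_univ _,
            Finset.mem_filter.2 ⟨Finset.mem_univ _, ha.symm⟩⟩)
      have h5 := (Finset.card_le_card h4).trans (Finset.card_union_le _ _)
      have h6 : (Finset.univ.biUnion fun a =>
          Finset.univ.filter fun c => M (ρ a) c ≠ M (y a) c).card ≤ s * d := by
        refine Finset.card_biUnion_le.trans ?_
        refine (Finset.sum_le_card_nsmul _ _ d fun a _ => ?_).trans (by simp)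
        refine le_trans (le_of_eq ?_) (hB a (y a) (h1 a (Fintype.mem_piFinset.1 hy a)))
        rw [rowDist, ← Set.ncard_coe_finset]
        congr 1
        ext; simp
      rw [hSm] at h5
      omega
    calc (m - s * d) ^ t = ∏ _b : Fin t, (m - s * d) := by simp
      _ ≤ _ := Finset.prod_le_prod' fun b _ => this b
  calc L ^ s * (m - s * d) ^ t = ∑ _y ∈ Fintype.piFinset B', (m - s * d) ^ t := by
        rw [Finset.sum_const, Fintype.card_piFinset]; simp [h2]
    _ ≤ ∑ y ∈ Fintype.piFinset B', (Fintype.piFinset (S' y)).card := Finset.sum_le_sum hS'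
    _ = ((Fintype.piFinset B').sigma fun y => Fintype.piFinset (S' y)).card :=
        (Finset.card_sigma _ _).symm
    _ = (((Fintype.piFinset B').sigma fun y => Fintype.piFinset (S' y) :
          Finset (Σ _ : Fin s → Fin n, Fin t → Fin n)) :
          Set (Σ _ : Fin s → Fin n, Fin t → Fin n)).ncard :=
        (Set.ncard_coe_finset _).symm
    _ ≤ patternCount A M := by
        apply Set.ncard_le_ncard_of_injOn (fun p => (p.1, p.2))
        · rintro ⟨y, c⟩ hp
          simp only [Finset.coe_sigma, Set.mem_sigma_iff, Finset.mem_coe,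
            Fintype.mem_piFinset] at hp
          obtain ⟨hy, hc⟩ := hp
          simp only [S', Finset.mem_filter] at hc
          refine ⟨?_, fun b b' h => hS b b' h _ (hc b).1 _ (hc b').1, fun a b => ?_⟩
          · intro a a' h
            have h' : y a = y a' := h
            by_contra hne
            rcases lt_or_gt_of_ne hne with h0 | h0
            · exact Finset.disjoint_left.1 (h3 _ _ h0) (hy a) (h' ▸ hy a')
            · exact Finset.disjoint_left.1 (h3 _ _ h0) (hy a') (h' ▸ hy a)
          · exact ((hc b).2 a).trans (hSA b _ (hc b).1 a)
        · rintro ⟨y, c⟩ - ⟨y', c'⟩ - h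
          simp only [Prod.mk.injEq] at h
          obtain ⟨rfl, rfl⟩ := h
          rfl

/-! ### Farness forces long blocks -/

/-- If replacing every row of `M` by one from a small set changes few entries of `M`, and `M` is
far from freeness, then some forbidden matrix occurs in long column blocks of these rows. -/
theorem IsFarFrom.exists_blocks {F : Set (AnyMatrix (Fin 2))} (hfin : F.Finite) {k n m : ℕ}
    (hk : ∀ A ∈ F, A.1 ≤ k ∧ A.2.1 ≤ k) {ε w : ℝ} {M : Matrix (Fin n) (Fin n) (Fin 2)}
    (hfar : IsFarFrom ε (matrixFreeness F) M) (T : Finset (Fin n)) (hT : T.Nonempty)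
    (τ : Fin n → T) (hw : (hfin.toFinset.card * (T.card ^ k * (k * m)) : ℕ) ≤ w) (hwn : w < n)
    (hε : ({p : Fin n × Fin n | M p.1 p.2 ≠ M (τ p.1) p.2}.ncard : ℝ) + w * n < ε * (n * n)) :
    ∃ A ∈ F, ∃ (ρ : Fin A.1 → T) (S : Fin A.2.1 → Finset (Fin n)), (∀ b, (S b).card = m) ∧
      (∀ b, ∀ c ∈ S b, ∀ a, M (ρ a) c = A.2.2 a b) ∧
      ∀ b b', b < b' → ∀ c ∈ S b, ∀ c' ∈ S b', c < c' := by
  classical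
  by_contra hno
  push Not at hno
  have hZ : ∀ (A : AnyMatrix (Fin 2)) (ρ : Fin A.1 → T), ∃ Z : Finset (Fin n),
      Z.card ≤ A.2.1 * m ∧ (A ∈ F → ∀ q : Fin A.2.1 → Fin n, Monotone q →
        (∀ b a, M (ρ a) (q b) = A.2.2 a b) → ∃ b, q b ∈ Z) := by
    intro A ρ
    by_cases hA : A ∈ F
    · rcases exists_blocks_or_hitting m A.2.1 (fun b c => ∀ a, M (ρ a) c = A.2.2 a b) with
        ⟨S, h1, h2, h3⟩ | ⟨Z, h1, h2⟩
      · obtain ⟨b, b', hb, c, hc, c', hc', h⟩ := hno A hA ρ S h1 h2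
        exact absurd (h3 b b' hb c hc c' hc') (not_lt.2 h)
      · exact ⟨Z, h1, fun _ => h2⟩
    · exact ⟨∅, by simp, fun h => absurd h hA⟩
  choose Z hZm hZq using hZ
  let U : Finset (Fin n) := hfin.toFinset.biUnion fun A => Finset.univ.biUnion fun ρ => Z A ρ
  have hU : (U.card : ℝ) ≤ w := by
    refine le_trans ?_ hw
    norm_cast
    refine Finset.card_biUnion_le.trans ?_
    rw [← smul_eq_mul]
    refine Finset.sum_le_card_nsmul _ _ _ fun A hA => ?_
    obtain ⟨hs, ht⟩ := hk A (hfin.mem_toFinset.1 hA)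
    refine Finset.card_biUnion_le.trans ?_
    refine (Finset.sum_le_card_nsmul _ _ (k * m) fun ρ _ =>
      (hZm A ρ).trans (Nat.mul_le_mul_right _ ht)).trans ?_
    rw [smul_eq_mul]
    refine Nat.mul_le_mul_right _ ?_
    simp only [Finset.card_univ, Fintype.card_fun, Fintype.card_fin, Fintype.card_coe]
    exact Nat.pow_le_pow_right hT.card_pos hs
  obtain ⟨φ, hφm, hφU, hφ⟩ := exists_monotone_retraction U fun h => by
    rw [h, Finset.card_univ, Fintype.card_fin] at hU
    linarith
  -- A copy of `A` in `N` at `(x, y)` would be a weakly ordered occurrence `φ ∘ y` in the rows `τ ∘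
  -- x` that avoids `U`, contradicting the choice of `U`.
  let N : Matrix (Fin n) (Fin n) (Fin 2) := fun x c => M (τ x) (φ c)
  have hN : (⟨n, n, N⟩ : AnyMatrix (Fin 2)) ∈ matrixFreeness F := by
    intro A hA
    rw [Set.eq_empty_iff_forall_notMem]
    rintro ⟨x, y⟩ hxy
    obtain ⟨b, hb⟩ := hZq A (τ ∘ x) hA (φ ∘ y) (hφm.comp y.monotone) fun b a => by
      have h : N.submatrix x y = A.2.2 := hxy
      exact congrFun (congrFun h a) b
    exact hφU (y b) (Finset.mem_biUnion.2 ⟨A, hfin.mem_toFinset.2 hA,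
      Finset.mem_biUnion.2 ⟨τ ∘ x, Finset.mem_univ _, hb⟩⟩)
  have hchange : numChanges M N ≤
      {p : Fin n × Fin n | M p.1 p.2 ≠ M (τ p.1) p.2}.ncard + n * U.card := by
    have h1 : {p : Fin n × Fin n | M p.1 p.2 ≠ N p.1 p.2} ⊆
        {p : Fin n × Fin n | M p.1 p.2 ≠ M (τ p.1) p.2} ∪
          ((Finset.univ ×ˢ U : Finset (Fin n × Fin n)) : Set (Fin n × Fin n)) := by
      rintro ⟨x, c⟩ h
      by_cases hc : c ∈ U
      · exact Or.inr (by simpa using hc)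
      · refine Or.inl ?_
        have h' : M x c ≠ M (τ x) (φ c) := h
        rwa [hφ c hc] at h'
    have h2 := (Set.ncard_le_ncard h1).trans (Set.ncard_union_le _ _)
    rw [Set.ncard_coe_finset, Finset.card_product, Finset.card_univ, Fintype.card_fin] at h2
    exact h2
  have h3 := hfar N hN
  have h4 : (numChanges M N : ℝ) ≤
      {p : Fin n × Fin n | M p.1 p.2 ≠ M (τ p.1) p.2}.ncard + n * U.card := by
    exact_mod_cast hchange
  have h5 : (n : ℝ) * U.card ≤ n * w := mul_le_mul_of_nonneg_left hU (Nat.cast_nonneg n)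
  linarith

theorem ncard_replace_le {n : ℕ} (M : Fin n → Fin n → Fin 2) (τ : Fin n → Fin n) (G : Set (Fin n))
    {r : ℝ} (hr : 0 ≤ r) (hG : ∀ x ∈ G, (rowDist M x (τ x) : ℝ) ≤ r) :
    ({p : Fin n × Fin n | M p.1 p.2 ≠ M (τ p.1) p.2}.ncard : ℝ) ≤ n * r + Gᶜ.ncard * n := by
  have h1 : {p : Fin n × Fin n | M p.1 p.2 ≠ M (τ p.1) p.2} ⊆
      {p | p.1 ∈ G ∧ M p.1 p.2 ≠ M (τ p.1) p.2} ∪ Gᶜ ×ˢ Set.univ := by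
    rintro ⟨x, c⟩ h
    by_cases hx : x ∈ G
    · exact Or.inl ⟨hx, h⟩
    · exact Or.inr ⟨hx, trivial⟩
  have h2 := (Set.ncard_le_ncard h1).trans (Set.ncard_union_le _ _)
  rw [Set.ncard_prod, Set.ncard_univ, Nat.card_fin] at h2
  have h3 : ({p : Fin n × Fin n | p.1 ∈ G ∧ M p.1 p.2 ≠ M (τ p.1) p.2}.ncard : ℝ) ≤ n * r := by
    refine (ncard_sigma_le _ r fun x => ?_).trans (by simp)
    by_cases hx : x ∈ G
    · refine le_trans (le_of_eq ?_) (hG x hx)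
      simp only [Set.mem_ofPred_eq, hx, true_and]
      rfl
    · simpa [hx] using hr
  have h4 : ({p : Fin n × Fin n | M p.1 p.2 ≠ M (τ p.1) p.2}.ncard : ℝ) ≤
      {p : Fin n × Fin n | p.1 ∈ G ∧ M p.1 p.2 ≠ M (τ p.1) p.2}.ncard + Gᶜ.ncard * n := by
    exact_mod_cast h2
  linarith

/-- A copy of `A` in column blocks of length `η n`, in rows with `γ n` rows within distance `β n`,
yields many copies of `A` up to the order of the rows. -/
theorem patternCount_of_long_blocks {n s t k m : ℕ} {β γ η κ : ℝ}
    (hκn : 1 ≤ κ * n) (hκγ : κ * (2 * (k + 1)) = γ) (hβη : β * (2 * (k + 1)) = η)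
    (hκη : 2 * κ ≤ η) (hβ0 : 0 ≤ β) (hs : s ≤ k) (M : Fin n → Fin n → Fin 2)
    (A : Matrix (Fin s) (Fin t) (Fin 2)) (ρ : Fin s → Fin n)
    (hρ : ∀ a, γ * n ≤ ({y | (rowDist M (ρ a) y : ℝ) ≤ β * n}.ncard : ℝ))
    (S : Fin t → Finset (Fin n)) (hm : η * n ≤ m) (hSm : ∀ b, (S b).card = m)
    (hSA : ∀ b, ∀ c ∈ S b, ∀ a, M (ρ a) c = A a b)
    (hS : ∀ b b', b < b' → ∀ c ∈ S b, ∀ c' ∈ S b', c < c') :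
    (κ * n) ^ s * (κ * n) ^ t ≤ patternCount A M := by
  classical
  have hs' : (s : ℝ) ≤ k := by exact_mod_cast hs
  have hβn : 0 ≤ β * n := by positivity
  have hκn0 : 0 ≤ κ * n := zero_le_one.trans hκn
  let B : Fin s → Finset (Fin n) := fun a =>
    Finset.univ.filter fun y => (rowDist M (ρ a) y : ℝ) ≤ β * n
  have hB : ∀ a, s * ⌈κ * n⌉₊ ≤ (B a).card := by
    intro a
    have h3 := hρ a
    have h4 : {y | (rowDist M (ρ a) y : ℝ) ≤ β * n} = (B a : Set (Fin n)) := by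
      ext; simp [B]
    rw [h4, Set.ncard_coe_finset] at h3
    have h5 : ((s * ⌈κ * n⌉₊ : ℕ) : ℝ) ≤ γ * n := by
      push_cast
      have h6 := (Nat.ceil_lt_add_one (zero_le_one.trans hκn)).le
      calc (s : ℝ) * ⌈κ * n⌉₊ ≤ k * (κ * n + 1) := by gcongr
        _ ≤ k * (κ * n + κ * n) := by gcongr
        _ ≤ γ * n := by
          rw [← hκγ]
          linarith
    exact_mod_cast h5.trans h3
  -- Up to `k` exchanged rows lose at most `k * β * n ≤ η * n / 2` columns per block, leaving at
  -- least `κ * n`.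
  have hcount := patternCount_of_blocks (d := ⌊β * n⌋₊) M A ρ B
    (fun a y hy => Nat.le_floor (Finset.mem_filter.1 hy).2) hB S hSm hSA hS
  have hcount' : ((⌈κ * n⌉₊ : ℕ) : ℝ) ^ s * ((m - s * ⌊β * n⌋₊ : ℕ) : ℝ) ^ t ≤
      patternCount A M := by exact_mod_cast hcount
  have h3 : (m : ℝ) ≤ (m - s * ⌊β * n⌋₊ : ℕ) + s * ⌊β * n⌋₊ := by
    exact_mod_cast le_tsub_add
  have h4 : (s : ℝ) * ⌊β * n⌋₊ ≤ k * (β * n) := by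
    gcongr
    exact Nat.floor_le hβn
  have h5 : k * (β * n) * 2 ≤ η * n := by
    rw [← hβη]
    linarith
  have h6 : 2 * κ * n ≤ η * n := by gcongr
  refine le_trans (mul_le_mul (pow_le_pow_left₀ (by positivity) (Nat.le_ceil _) _)
    (pow_le_pow_left₀ (by positivity) ?_ _) (by positivity) (by positivity)) hcount'
  linarith

/-! ### The two-scale argument -/

/-- The two-scale argument: `β₁`, `γ₁` control the net of rows, and `β₂`, `γ₂` the rows close to
the rows of the net. -/
theorem IsFarFrom.exists_patternCount {F : Set (AnyMatrix (Fin 2))} (hfin : F.Finite) {k n : ℕ}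
    (hk : ∀ A ∈ F, A.1 ≤ k ∧ A.2.1 ≤ k) {M : Matrix (Fin n) (Fin n) (Fin 2)}
    {ε β₁ γ₁ η β₂ γ₂ κ : ℝ} (hε : 0 < ε) (hε1 : ε ≤ 1) (hβ₁ : β₁ = ε / 16) (hγ₁ : 0 < γ₁)
    (hγ₁1 : γ₁ ≤ 1)
    (hη : η = ε * γ₁ ^ k / (8 * (k + 1) * (hfin.toFinset.card + 1)))
    (hβ₂ : β₂ = η / (2 * (k + 1))) (hγ₂ : 0 < γ₂) (hγβ : γ₂ ≤ β₂)
    (hκ : κ = γ₂ / (2 * (k + 1))) (hκn : 1 ≤ κ * n)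
    (hfar : IsFarFrom ε (matrixFreeness F) M)
    (h₁ : ∀ X : Finset (Fin n), (∀ x ∈ X, ({y | (rowDist M x y : ℝ) ≤ β₁ * n}.ncard : ℝ)
      ≤ γ₁ * n) → X.card < β₁ * n)
    (h₂ : ∀ X : Finset (Fin n), (∀ x ∈ X, ({y | (rowDist M x y : ℝ) ≤ β₂ * n}.ncard : ℝ)
      ≤ γ₂ * n) → X.card < β₂ * n) :
    ∃ A ∈ F, (κ * n) ^ A.1 * (κ * n) ^ A.2.1 ≤ patternCount A.2.2 M := by
  classical
  set f : ℕ := hfin.toFinset.card with hf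
  have hk0 : (0 : ℝ) ≤ k := Nat.cast_nonneg k
  have hf0 : (0 : ℝ) ≤ f := Nat.cast_nonneg f
  have hk1 : (0 : ℝ) < 2 * (k + 1) := by positivity
  have hκ0 : 0 < κ := by rw [hκ]; positivity
  have hn : (0 : ℝ) < n := by
    by_contra! h
    nlinarith
  have hn0 : 0 < n := by exact_mod_cast hn
  have hη0 : 0 < η := by rw [hη]; positivity
  have hγk : γ₁ ^ k ≤ 1 := pow_le_one₀ hγ₁.le hγ₁1
  have hβη : β₂ * (2 * (k + 1)) = η := by rw [hβ₂]; field_simp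
  have hκγ : κ * (2 * (k + 1)) = γ₂ := by rw [hκ]; field_simp
  have hβ₂0 : 0 < β₂ := by rw [hβ₂]; positivity
  have hηε : η * (8 * (k + 1) * (f + 1)) = ε * γ₁ ^ k := by rw [hη]; field_simp
  have hη8 : 8 * η ≤ ε := by
    have h1 : (1 : ℝ) ≤ (k + 1) * (f + 1) := by nlinarith
    have h2 : η * 8 * 1 ≤ η * 8 * ((k + 1) * (f + 1)) := by gcongr
    have h3 : ε * γ₁ ^ k ≤ ε * 1 := by gcongr
    linarith
  have hβ₂η : 2 * β₂ ≤ η := by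
    have : 0 ≤ β₂ * k := by positivity
    linarith
  have hκη : 2 * κ ≤ η := by
    have : 0 ≤ κ * k := by positivity
    linarith
  let X₁ : Finset (Fin n) := Finset.univ.filter fun x =>
    ({y | (rowDist M x y : ℝ) ≤ β₁ * n}.ncard : ℝ) ≤ γ₁ * n
  let X₂ : Finset (Fin n) := Finset.univ.filter fun x =>
    ({y | (rowDist M x y : ℝ) ≤ β₂ * n}.ncard : ℝ) ≤ γ₂ * n
  have hX₁ := h₁ X₁ fun x hx => (Finset.mem_filter.1 hx).2
  have hX₂ := h₂ X₂ fun x hx => (Finset.mem_filter.1 hx).2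
  let G : Finset (Fin n) := (X₁ ∪ X₂)ᶜ
  have hXX : ((X₁ ∪ X₂).card : ℝ) ≤ (ε / 8) * n := by
    have h3 : ((X₁ ∪ X₂).card : ℝ) ≤ X₁.card + X₂.card := by
      exact_mod_cast Finset.card_union_le _ _
    have h4 : β₁ * n + β₂ * n ≤ (ε / 8) * n := by
      rw [← add_mul]
      gcongr
      linarith
    linarith
  have hG₁ : ∀ x ∈ G, γ₁ * n ≤ ({y | (rowDist M x y : ℝ) ≤ β₁ * n}.ncard : ℝ) := by
    intro x hx
    by_contra! h
    exact Finset.mem_compl.1 hx (Finset.mem_union_left _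
      (Finset.mem_filter.2 ⟨Finset.mem_univ _, h.le⟩))
  have hG₂ : ∀ x ∈ G, γ₂ * n ≤ ({y | (rowDist M x y : ℝ) ≤ β₂ * n}.ncard : ℝ) := by
    intro x hx
    by_contra! h
    exact Finset.mem_compl.1 hx (Finset.mem_union_right _
      (Finset.mem_filter.2 ⟨Finset.mem_univ _, h.le⟩))
  have hβn : 0 ≤ β₁ * n := by rw [hβ₁]; positivity
  obtain ⟨T, hTG, hTγ, hTnet⟩ := exists_small_net M hn0 hβn G hG₁
  have hTne : T.Nonempty := by
    have : G.Nonempty := by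
      rw [Finset.nonempty_iff_ne_empty]
      intro h
      rw [Finset.compl_eq_empty_iff] at h
      rw [h, Finset.card_univ, Fintype.card_fin] at hXX
      nlinarith
    obtain ⟨x, hx⟩ := this
    obtain ⟨y, hy, -⟩ := hTnet x hx
    exact ⟨y, hy⟩
  have hτ : ∀ x : Fin n, ∃ y : T, x ∈ G → (rowDist M x y : ℝ) ≤ 2 * (β₁ * n) := by
    intro x
    by_cases hx : x ∈ G
    · obtain ⟨y, hy, hxy⟩ := hTnet x hx
      exact ⟨⟨y, hy⟩, fun _ => hxy⟩
    · obtain ⟨y, hy⟩ := hTne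
      exact ⟨⟨y, hy⟩, fun h => absurd h hx⟩
  choose τ hτ using hτ
  set m := ⌈η * n⌉₊ with hm
  have hηn : 1 ≤ η * n := by
    have : κ * n ≤ η * n := by gcongr; linarith
    linarith
  have hm1 : η * n ≤ m := Nat.le_ceil _
  have hm2 : (m : ℝ) ≤ 2 * (η * n) := by
    have := (Nat.ceil_lt_add_one (zero_le_one.trans hηn)).le
    linarith
  have hTk : (T.card : ℝ) ^ k * γ₁ ^ k ≤ 1 := by
    rw [← mul_pow]
    exact pow_le_one₀ (by positivity) hTγ
  -- This fixes `η`: the hitting sets for all `A` and all assignments of at most `γ₁⁻¹` net rows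
  -- must together have at most `ε * n / 4` columns.
  have hw : ((f * (T.card ^ k * (k * m)) : ℕ) : ℝ) ≤ (ε / 4) * n := by
    push_cast
    have h3 : (f : ℝ) * k ≤ (k + 1) * (f + 1) := by nlinarith
    calc (f : ℝ) * (T.card ^ k * (k * m)) ≤ f * (T.card ^ k * (k * (2 * (η * n)))) := by gcongr
      _ = (f * k) * (2 * T.card ^ k * (η * n)) := by ring
      _ ≤ ((k + 1) * (f + 1)) * (2 * T.card ^ k * (η * n)) := by gcongr
      _ = (T.card : ℝ) ^ k * (η * (8 * (k + 1) * (f + 1))) * n / 4 := by ring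
      _ = (T.card : ℝ) ^ k * γ₁ ^ k * (ε * n / 4) := by rw [hηε]; ring
      _ ≤ 1 * (ε * n / 4) := by gcongr
      _ = _ := by ring
  have hrep := ncard_replace_le M (fun x => (τ x : Fin n)) (G : Set (Fin n)) (r := 2 * (β₁ * n))
    (by positivity) fun x hx => hτ x hx
  have hGc : ((G : Set (Fin n))ᶜ.ncard : ℝ) ≤ (ε / 8) * n := by
    rw [← Finset.coe_compl, compl_compl, Set.ncard_coe_finset]
    exact hXX
  -- Budget in units of `ε * n ^ 2`: 1/8 for moving rows of `G` to the net, 1/8 for rows outside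
  -- `G`, 1/4 for the overwritten columns.
  obtain ⟨A, hA, ρ, S, hS1, hS2, hS3⟩ := hfar.exists_blocks hfin hk T hTne τ hw (by nlinarith) (by
    have h3 : (n : ℝ) * (2 * (β₁ * n)) = ε / 8 * (n * n) := by rw [hβ₁]; ring
    have h4 : ((G : Set (Fin n))ᶜ.ncard : ℝ) * n ≤ ε / 8 * n * n := by gcongr
    have h5 : 0 < ε * (n * n) := by positivity
    linarith)
  exact ⟨A, hA, patternCount_of_long_blocks hκn hκγ hβη hκη hβ₂0.le (hk A hA).1 M A.2.2
    (fun a => ρ a) (fun a => hG₂ _ (hTG (ρ a).2)) S hm1 hS1 hS2 hS3⟩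

/-! ### Choice of constants and conclusion -/

theorem exists_patternCount_pos {F : Set (AnyMatrix (Fin 2))} {n : ℕ} (hn : 0 < n) {ε : ℝ}
    (hε : 0 < ε) {M : Matrix (Fin n) (Fin n) (Fin 2)}
    (hfar : IsFarFrom ε (matrixFreeness F) M) : ∃ A ∈ F, 1 ≤ patternCount A.2.2 M := by
  by_contra! h
  have hM : (⟨n, n, M⟩ : AnyMatrix (Fin 2)) ∈ matrixFreeness F := by
    intro A hA
    rw [Set.eq_empty_iff_forall_notMem]
    rintro ⟨x, y⟩ hxy
    have h0 : patternCount A.2.2 M = 0 := Nat.lt_one_iff.1 (h A hA)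
    have h0 : patternSet A.2.2 M = ∅ := (Set.ncard_eq_zero (Set.toFinite _)).1 h0
    have : ((x : Fin A.1 → Fin n), (y : Fin A.2.1 → Fin n)) ∈ patternSet A.2.2 M :=
      ⟨x.injective, fun b b' hb => y.strictMono hb, fun a b => by
        have h1 : M.submatrix x y = A.2.2 := hxy
        exact congrFun (congrFun h1 a) b⟩
    rw [h0] at this
    exact this
  have h1 := hfar M hM
  have h2 : numChanges M M = 0 := by simp [numChanges]
  rw [h2] at h1
  have : (0 : ℝ) < n := by exact_mod_cast hn
  have : 0 < ε * (n * n : ℝ) := by positivity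
  push_cast at h1
  linarith

theorem exists_patternCount_bound_of_isFarFrom (F : Set (AnyMatrix (Fin 2))) (hfin : F.Finite)
    (hne : F.Nonempty) {k : ℕ} (hk : ∀ A ∈ F, A.1 ≤ k ∧ A.2.1 ≤ k) :
    ∃ c : ℝ, 0 < c ∧ ∃ D : ℕ, ∀ ε : ℝ, 0 < ε → ε ≤ 1 → ∀ n : ℕ, 1 ≤ n →
      ∀ M : Matrix (Fin n) (Fin n) (Fin 2), IsFarFrom ε (matrixFreeness F) M →
        ∃ A ∈ F, c * ε ^ D * (n : ℝ) ^ (A.1 + A.2.1) ≤ patternCount A.2.2 M := by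
  obtain ⟨A₀, hA₀⟩ := hne
  obtain ⟨c, hc, hc1, D, hD, hbound⟩ := exists_patternCount_bound A₀.1 A₀.2.1
  set f : ℕ := hfin.toFinset.card with hf
  set E := 1 + D * k with hE
  -- Each of `γ₁`, `η`, `β₂`, `γ₂`, `κ` below is a monomial in `ε`; `a₁`, …, `a₅` are their
  -- coefficients.
  set a₁ : ℝ := c * (1 / 16) ^ D with ha₁
  set a₂ : ℝ := a₁ ^ k / (8 * (k + 1) * (f + 1)) with ha₂
  set a₃ : ℝ := a₂ / (2 * (k + 1)) with ha₃
  set a₄ : ℝ := c * a₃ ^ D with ha₄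
  set a₅ : ℝ := a₄ / (2 * (k + 1)) with ha₅
  -- The bound is `κ ^ (2 * k + 1)`: `2 * k` covers the dimensions of `A`, and the extra 1 keeps it
  -- below `κ` even for `k = 0`.
  refine ⟨a₅ ^ (2 * k + 1), by positivity, E * D * (2 * k + 1), ?_⟩
  intro ε hε hε1 n hn M hfar
  have hk0 : (0 : ℝ) ≤ k := Nat.cast_nonneg k
  have hf0 : (0 : ℝ) ≤ f := Nat.cast_nonneg f
  set β₁ : ℝ := ε / 16 with hβ₁
  set γ₁ : ℝ := c * β₁ ^ D with hγ₁
  set η : ℝ := ε * γ₁ ^ k / (8 * (k + 1) * (f + 1)) with hη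
  set β₂ : ℝ := η / (2 * (k + 1)) with hβ₂
  set γ₂ : ℝ := c * β₂ ^ D with hγ₂
  set κ : ℝ := γ₂ / (2 * (k + 1)) with hκ
  have hγ₁0 : 0 < γ₁ := by positivity
  have hη0 : 0 < η := by positivity
  have hγ₂0 : 0 < γ₂ := by positivity
  have hκ0 : 0 < κ := by positivity
  have hn0 : (0 : ℝ) < n := by exact_mod_cast hn
  have hγ₁1 : γ₁ ≤ 1 := mul_le_one₀ hc1 (by positivity)
    (pow_le_one₀ (by positivity) (by rw [hβ₁]; linarith))
  have hηε : η ≤ ε / 8 := by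
    have h1 : γ₁ ^ k ≤ 1 := pow_le_one₀ hγ₁0.le hγ₁1
    have h2 : (1 : ℝ) ≤ (k + 1) * (f + 1) := by nlinarith
    rw [hη, div_le_div_iff₀ (by positivity) (by norm_num)]
    have h3 : ε * γ₁ ^ k ≤ ε * 1 := by gcongr
    have h4 : ε * 1 ≤ ε * ((k + 1) * (f + 1)) := by gcongr
    linarith
  have hβ₂η : β₂ ≤ η / 2 := by
    rw [hβ₂]
    gcongr
    linarith
  have hβ₂0 : 0 < β₂ := by positivity
  have hβ₂1 : β₂ ≤ 1 := by linarith
  have hγβ : γ₂ ≤ β₂ := by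
    have h1 : β₂ ^ D ≤ β₂ := pow_le_of_le_one hβ₂0.le hβ₂1 (by omega)
    have h2 : c * β₂ ^ D ≤ 1 * β₂ ^ D := by gcongr
    linarith
  have hγγ : γ₂ ≤ γ₁ := by
    have h1 : β₂ ≤ β₁ := by rw [hβ₁]; linarith
    rw [hγ₁, hγ₂]
    gcongr
  have hκγ : κ ≤ γ₂ := div_le_self hγ₂0.le (by linarith)
  have hκ1 : κ ≤ 1 := by linarith
  have hκeq : a₅ ^ (2 * k + 1) * ε ^ (E * D * (2 * k + 1)) = κ ^ (2 * k + 1) := by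
    have h1 : γ₁ = a₁ * ε ^ D := by rw [hγ₁, hβ₁, ha₁]; ring
    have h2 : η = a₂ * ε ^ E := by rw [hη, h1, ha₂, hE]; ring
    have h3 : β₂ = a₃ * ε ^ E := by rw [hβ₂, h2, ha₃]; ring
    have h4 : γ₂ = a₄ * ε ^ (E * D) := by rw [hγ₂, h3, ha₄]; ring
    have h5 : κ = a₅ * ε ^ (E * D) := by rw [hκ, h4, ha₅]; ring
    rw [h5, pow_mul, mul_pow]
  rw [hκeq]
  have hκpow : ∀ A ∈ F, κ ^ (2 * k + 1) * (n : ℝ) ^ (A.1 + A.2.1) ≤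
      (κ * n) ^ A.1 * (κ * n) ^ A.2.1 := by
    intro A hA
    obtain ⟨hs, ht⟩ := hk A hA
    rw [← pow_add, mul_pow]
    gcongr ?_ * _
    exact pow_le_pow_of_le_one hκ0.le hκ1 (by omega)
  -- If `κ * n < 1`, one copy is enough. Otherwise, if either scale has many rows with few close
  -- rows, every matrix of the size of `A₀` is abundant, in particular `A₀`.
  by_cases hκn : 1 ≤ κ * n
  · have hκle : κ ^ (2 * k + 1) ≤ κ := pow_le_of_le_one hκ0.le hκ1 (by omega)
    by_cases h₁ : ∀ X : Finset (Fin n), (∀ x ∈ X, ({y | (rowDist M x y : ℝ) ≤ β₁ * n}.ncard : ℝ)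
      ≤ γ₁ * n) → X.card < β₁ * n
    · by_cases h₂ : ∀ X : Finset (Fin n), (∀ x ∈ X,
          ({y | (rowDist M x y : ℝ) ≤ β₂ * n}.ncard : ℝ) ≤ γ₂ * n) → X.card < β₂ * n
      · obtain ⟨A, hA, h⟩ := hfar.exists_patternCount hfin hk hε hε1 hβ₁ hγ₁0 hγ₁1 hη hβ₂ hγ₂0
          hγβ hκ hκn h₁ h₂
        exact ⟨A, hA, (hκpow A hA).trans h⟩
      · push Not at h₂
        obtain ⟨X, h1, h2⟩ := h₂
        refine ⟨A₀, hA₀, le_trans ?_ (hbound β₂ hβ₂0 hβ₂1 n hn M X h2 h1 A₀.2.2)⟩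
        gcongr ?_ * _
        linarith
    · push Not at h₁
      obtain ⟨X, h1, h2⟩ := h₁
      refine ⟨A₀, hA₀, le_trans ?_ (hbound β₁ (by positivity) (by rw [hβ₁]; linarith) n hn M X
        h2 h1 A₀.2.2)⟩
      gcongr ?_ * _
      linarith
  · push Not at hκn
    obtain ⟨A, hA, h⟩ := exists_patternCount_pos hn hε hfar
    refine ⟨A, hA, (hκpow A hA).trans ?_⟩
    have h1 : (1 : ℝ) ≤ patternCount A.2.2 M := by exact_mod_cast h
    rw [← pow_add]
    exact (pow_le_one₀ (by positivity) hκn.le).trans h1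

/-- Pigeonhole over the `s!` orders of the rows. -/
theorem exists_numCopies_of_patternCount {s t n : ℕ} (A : Matrix (Fin s) (Fin t) (Fin 2))
    (M : Matrix (Fin n) (Fin n) (Fin 2)) {u : ℝ} (hu : u ≤ patternCount A M) :
    ∃ σ : Equiv.Perm (Fin s), u / s.factorial ≤ numCopies (A.submatrix σ id) M := by
  by_contra! h
  have h1 : (patternCount A M : ℝ) ≤ ∑ σ : Equiv.Perm (Fin s),
      (numCopies (A.submatrix σ id) M : ℝ) := by
    exact_mod_cast patternCount_le_sum_numCopies A M
  have h2 : ∑ σ : Equiv.Perm (Fin s), (numCopies (A.submatrix σ id) M : ℝ) <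
      ∑ _σ : Equiv.Perm (Fin s), u / s.factorial :=
    Finset.sum_lt_sum_of_nonempty Finset.univ_nonempty fun σ _ => h σ
  have h3 : ∑ _σ : Equiv.Perm (Fin s), u / (s.factorial : ℝ) = u := by
    have : (s.factorial : ℝ) ≠ 0 := by exact_mod_cast s.factorial_ne_zero
    rw [Finset.sum_const, Finset.card_univ, Fintype.card_perm, Fintype.card_fin, nsmul_eq_mul]
    field_simp
  linarith

theorem mainTheorem2 (F : Set (AnyMatrix (Fin 2))) (hfin : F.Finite)
    (hF : ClosedUnderRowPerm F) :
    ∃ p : Polynomial ℝ, ∀ ε : ℝ, 0 < ε →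
      ∃ δ : ℝ, 0 < δ ∧ δ⁻¹ ≤ p.eval ε⁻¹ ∧
        ∀ n : ℕ, 1 ≤ n → ∀ M : Matrix (Fin n) (Fin n) (Fin 2),
          IsFarFrom ε (matrixFreeness F) M →
            ∃ (s t : ℕ) (A : Matrix (Fin s) (Fin t) (Fin 2)),
              (⟨s, t, A⟩ : AnyMatrix (Fin 2)) ∈ F ∧
                δ * (n : ℝ) ^ (s + t) ≤ (numCopies A M : ℝ) := by
  rcases F.eq_empty_or_nonempty with rfl | hne
  · refine ⟨1, fun ε hε => ⟨1, one_pos, by simp, fun n hn M hfar => ?_⟩⟩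
    obtain ⟨A, hA, -⟩ := exists_patternCount_pos hn hε hfar
    exact absurd hA (Set.notMem_empty A)
  obtain ⟨k, hk⟩ : ∃ k : ℕ, ∀ A ∈ F, A.1 ≤ k ∧ A.2.1 ≤ k := by
    obtain ⟨k, hk⟩ := (hfin.image fun A => A.1 + A.2.1).bddAbove
    refine ⟨k, fun A hA => ?_⟩
    have : A.1 + A.2.1 ≤ k := hk (Set.mem_image_of_mem _ hA)
    omega
  obtain ⟨c, hc, D, h⟩ := exists_patternCount_bound_of_isFarFrom F hfin hne hk
  refine ⟨Polynomial.C (k.factorial / c) * (1 + Polynomial.X) ^ D, fun ε hε => ?_⟩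
  -- The case `ε > 1` is not vacuous: if no matrix of the given size is `F`-free, every one is far
  -- for every `ε`.
  have hε' : 0 < min ε 1 := lt_min hε one_pos
  have hk0 : (0 : ℝ) < k.factorial := by exact_mod_cast k.factorial_pos
  refine ⟨c * (min ε 1) ^ D / k.factorial, by positivity, ?_, ?_⟩
  · have h1 : (min ε 1)⁻¹ ≤ 1 + ε⁻¹ := by
      rcases min_choice ε 1 with h | h <;> rw [h]
      · linarith
      · rw [inv_one]
        have := inv_pos.2 hε
        linarith
    simp only [Polynomial.eval_mul, Polynomial.eval_C, Polynomial.eval_pow, Polynomial.eval_add,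
      Polynomial.eval_one, Polynomial.eval_X]
    calc (c * (min ε 1) ^ D / k.factorial)⁻¹ = k.factorial / c * ((min ε 1)⁻¹) ^ D := by
          rw [inv_pow]; field_simp
      _ ≤ _ := by gcongr
  · intro n hn M hfar
    have hfar' : IsFarFrom (min ε 1) (matrixFreeness F) M := fun N hN =>
      (mul_le_mul_of_nonneg_right (min_le_left _ _) (by positivity)).trans (hfar N hN)
    obtain ⟨A, hA, hcount⟩ := h _ hε' (min_le_right _ _) n hn M hfar'
    obtain ⟨σ, hσ⟩ := exists_numCopies_of_patternCount A.2.2 M hcount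
    refine ⟨A.1, A.2.1, A.2.2.submatrix σ id, hF _ _ _ hA σ, le_trans ?_ hσ⟩
    rw [div_mul_eq_mul_div]
    gcongr
    exact (hk A hA).1
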